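/- Let $(W,S)$ be the Coxeter system of a Weyl group, i.e. $W$ is finite and the order $m(s,s')$ of $ss'$ lies in $\{2,3,4,6\}$ for all distinct $s,s'\in S$. Let $\ell$ be the length function and $T=\{xsx^{-1}: x\in W,\ s\in S\}$ the set of reflections; write $x\to y$ if $y=tx$ for some $t\in T$ and $\ell(x)<\ell(y)$. The Bruhat order on $W$ is defined by $x\le y$ if there is a (possibly empty) chain $x=x_0\to x_1\to\cdots\to x_k=y$. For $u<w$ in the Bruhat order put $[u,w]=\{y\in W: u\le y\le w\}$, and for $v\in[u,w]$ let $\deg_{u,w}(v)$ be the number of $v'\in[u,w]$ with $v\to v'$ or $v'\to v$. A special matching of a poset $P$ is an involution $M:P\to P$ such that for every $x\in P$ either $M(x)$ covers $x$ or $x$ covers $M(x)$, and such that whenever $y$ covers $x$ in $P$, one has $M(x)=y$ or $M(x)<M(y)$. A poset $P$ is a zircon if for every non-minimal $x\in P$ the principal order ideal $\{v\in P: v\le x\}$ is finite and has a special matching. Let $u<w$ in $W$. If the dual poset $[u,w]^*$ (the set $[u,w]$ with the reversed Bruhat order) is a zircon, then $[u,w]$ is rationally smooth, in the sense of the Carrell–Peterson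 condition: $\deg_{y,w}(y)=\ell(w)-\ell(y)$ for all $y\in[u,w]$. -/

import Mathlib

section Posets

/-- A matching of a poset: an involution moving every element along a covering relation. -/
def IsPosetMatching {P : Type*} [PartialOrder P] (M : P → P) : Prop :=
  Function.Involutive M ∧ ∀ x, M x ⋖ x ∨ x ⋖ M x

/-- A special matching of a poset. -/
def IsSpecialMatching {P : Type*} [PartialOrder P] (M : P → P) : Prop :=
  IsPosetMatching M ∧ ∀ x y, x ⋖ y → M x = y ∨ M x < M y

/-- A zircon: every principal order ideal generated by a non-minimal element is finite and,
as an induced subposet, has a special matching. -/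
def IsZircon (P : Type*) [PartialOrder P] : Prop :=
  ∀ x : P, ¬ IsMin x →
    (Set.Iic x).Finite ∧ ∃ M : Set.Iic x → Set.Iic x, IsSpecialMatching M

end Posets

namespace CoxeterSystem

section Bruhat

variable {B W : Type*} [Group W] {M : CoxeterMatrix B} (cs : CoxeterSystem M W)

/-- A Coxeter system is that of a Weyl group if the group is finite and the system is
crystallographic: the order of a product of two distinct simple reflections is 2, 3, 4 or 6. -/
structure IsWeyl (_cs : CoxeterSystem M W) : Prop where
  finite : Finite W
  crystallographic : ∀ i j : B, i ≠ j → M i j = 2 ∨ M i j = 3 ∨ M i j = 4 ∨ M i j = 6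

/-- The relation `u → w`: `w = t u` for a reflection `t`, and `ℓ(u) < ℓ(w)`. -/
def BruhatStep (u w : W) : Prop :=
  ∃ t : W, cs.IsReflection t ∧ w = t * u ∧ cs.length u < cs.length w

/-- The Bruhat order: `u ≤ w` if there is a (possibly empty) chain `u → ⋯ → w`. -/
def BruhatLE (u w : W) : Prop :=
  Relation.ReflTransGen cs.BruhatStep u w

theorem BruhatLE.eq_or_length_lt {cs : CoxeterSystem M W} {u w : W} (h : cs.BruhatLE u w) :
    u = w ∨ cs.length u < cs.length w := by
  induction h with
  | refl => exact Or.inl rfl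
  | tail _ hstep ih =>
    obtain ⟨t, -, -, hlt⟩ := hstep
    rcases ih with rfl | ih
    · exact Or.inr hlt
    · exact Or.inr (ih.trans hlt)

/-- The Bruhat order as a partial order on `W`. -/
@[reducible]
def bruhatOrder : PartialOrder W where
  le := cs.BruhatLE
  le_refl _ := Relation.ReflTransGen.refl
  le_trans _ _ _ h₁ h₂ := Relation.ReflTransGen.trans h₁ h₂
  le_antisymm u w h₁ h₂ := by
    rcases BruhatLE.eq_or_length_lt h₁ with h | h
    · exact h
    · rcases BruhatLE.eq_or_length_lt h₂ with h' | h'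
      · exact h'.symm
      · exact absurd h' h.asymm

/-- The Bruhat interval `[u, w]`, as a set of elements of `W`. -/
def bruhatInterval (u w : W) : Set W :=
  {y | cs.BruhatLE u y ∧ cs.BruhatLE y w}

/-- The Bruhat interval carries the order induced by the Bruhat order. -/
instance (u w : W) : PartialOrder (cs.bruhatInterval u w) :=
  @Subtype.partialOrder W cs.bruhatOrder (· ∈ cs.bruhatInterval u w)

/-- The (undirected) Bruhat graph of a Coxeter system. -/
def bruhatGraph : SimpleGraph W where
  Adj u v := cs.BruhatStep u v ∨ cs.BruhatStep v u
  symm := ⟨fun _ _ h => h.symm⟩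
  loopless := ⟨by
    rintro u (⟨_, _, _, h⟩ | ⟨_, _, _, h⟩) <;> exact lt_irrefl _ h⟩

/-- The degree of a vertex `v` in the Bruhat graph of `[u, w]`, which is the subgraph of the
Bruhat graph induced by `[u, w]`. -/
noncomputable def bruhatDegree (u w : W) (v : cs.bruhatInterval u w) : ℕ :=
  (((cs.bruhatGraph).induce (cs.bruhatInterval u w)).neighborSet v).ncard

/-- Rational smoothness of the Bruhat interval `[u, w]` (the Carrell–Peterson condition):
for every `y ∈ [u, w]`, the degree of `y` in the Bruhat graph of `[y, w]` is `ℓ(w) - ℓ(y)`. -/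
def IsRationallySmooth (u w : W) : Prop :=
  ∀ (y : W) (hy : y ∈ cs.bruhatInterval u w),
    (cs.bruhatDegree y w ⟨y, Relation.ReflTransGen.refl, hy.2⟩ : ℤ) =
      (cs.length w : ℤ) - (cs.length y : ℤ)

end Bruhat

end CoxeterSystem

/-!
For `z ∈ [u, w]` let `d z` be the number of edges `z → v` of the Bruhat graph with `v ≤ w`. The
Carrell–Peterson condition reads `d z = ℓ(w) - ℓ(z)`, and it is proved by induction on
`ℓ(w) - ℓ(z)`. For `z < w` the zircon hypothesis provides a special matching `m` of `[z, w]`. The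
key point is that `m` is an automorphism of the undirected Bruhat graph of `[z, w]`
(`IsIntervalMatching.isReflection`). Hence `m` carries the edges at `m z` to the edges at `z`; all
edges at `z` go up, and the only edge at `m z` going down is the one to `z`, as `m z` covers `z`. So
`d z = d (m z) + 1` (`IsIntervalMatching.ncard_upperNeighbors`).

That `m` preserves adjacency is proved by induction on the length of an edge `x → y`. If `y` covers
`x`, the only case that does not follow from the definition is `m x ⋖ x ⋖ y ⋖ m y`, where the
matching exhibits `[m x, m y]` as a crown of covering relations. If `ℓ(y) - ℓ(x) ≥ 3`, the edge
spans a crown `x → {b₁, b₂} → {c₁, c₂} → y` of shorter edges (`BruhatStep.exists_crown`), whose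
images under `m` are edges. In both cases the missing edge comes from the fact that eight of the
nine edges of a `K₃,₃` force the ninth (`isReflection_of_bipartite`).

The last fact is geometric. In the reflection representation of a finite Coxeter group, a nontrivial
product of two reflections determines the plane of their roots, so the reflections in question have
coplanar roots; a product of three reflections with coplanar roots acts as a reflection, and an
element acting as a reflection is one (`isReflection_of_geomRep_eq`). The representation is built
from the Coxeter matrix, with positivity of roots (`geomRep_simpleRoot_nonneg`) giving faithfulness
and the exchange property (`BruhatStep.mul_simple`). The existence of crowns follows from the latter
by induction along right descents.
-/

/-! ### The geometric representation and positivity of roots -/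

namespace CoxeterSystem

open Real

section GeometricRepresentation

variable {B W : Type*} [Group W] {M : CoxeterMatrix B}

/-- The symmetric bilinear form on `B →₀ ℝ` attached to a Coxeter matrix, normalised so that
`⟨αᵢ, αⱼ⟩ = -2 cos (π / M i j)`; each simple root has `⟨αᵢ, αᵢ⟩ = 2`. -/
noncomputable def rootForm (M : CoxeterMatrix B) : (B →₀ ℝ) →ₗ[ℝ] (B →₀ ℝ) →ₗ[ℝ] ℝ :=
  Finsupp.linearCombination ℝ fun i =>
    Finsupp.linearCombination ℝ fun j => -2 * cos (π / M i j)

/-- The simple root `αᵢ`, a basis vector of `B →₀ ℝ`. -/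
noncomputable abbrev simpleRoot (i : B) : B →₀ ℝ := Finsupp.single i 1

theorem rootForm_simpleRoot (i j : B) :
    rootForm M (simpleRoot i) (simpleRoot j) = -2 * cos (π / M i j) := by
  simp [rootForm]

theorem rootForm_simpleRoot_self (i : B) :
    rootForm M (simpleRoot i) (simpleRoot i) = 2 := by
  simp [rootForm_simpleRoot]

theorem rootForm_comm (v w : B →₀ ℝ) : rootForm M v w = rootForm M w v := by
  have : rootForm M = (rootForm M).flip := by
    ext i j
    simp only [LinearMap.coe_comp, Function.comp_apply, Finsupp.lsingle_apply,
      LinearMap.flip_apply]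
    rw [rootForm_simpleRoot, rootForm_simpleRoot, M.symmetric i j]
  rw [this, LinearMap.flip_apply, ← this]

/-- The linear map `v ↦ v - ⟨n, v⟩ n`, which is the orthogonal reflection along `n`
when `⟨n, n⟩ = 2`. -/
noncomputable def rootReflection (M : CoxeterMatrix B) (n : B →₀ ℝ) : Module.End ℝ (B →₀ ℝ) :=
  LinearMap.id - (rootForm M n).smulRight n

theorem rootReflection_apply (n v : B →₀ ℝ) :
    rootReflection M n v = v - rootForm M n v • n := by
  simp [rootReflection]

theorem rootReflection_mul_self {n : B →₀ ℝ} (hn : rootForm M n n = 2) :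
    rootReflection M n * rootReflection M n = 1 := by
  ext1 i
  ext1
  simp only [LinearMap.coe_comp, Function.comp_apply, Module.End.mul_apply, Module.End.one_apply,
    rootReflection_apply, map_sub, map_smul, hn]
  module

theorem two_cos_mul_sin (θ : ℝ) (n : ℕ) :
    2 * cos θ * sin ((n + 1 : ℕ) * θ) = sin ((n + 2 : ℕ) * θ) + sin (n * θ) := by
  have h1 : ((n + 2 : ℕ) : ℝ) * θ = (n + 1 : ℕ) * θ + θ := by push_cast; ring
  have h2 : (n : ℝ) * θ = (n + 1 : ℕ) * θ - θ := by push_cast; ring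
  rw [h1, h2, sin_add, sin_sub]; ring

theorem sin_pi_div_pos {m : ℕ} (hm : 2 ≤ m) : 0 < sin (π / m) := by
  have : (2 : ℝ) ≤ m := by exact_mod_cast hm
  apply sin_pos_of_pos_of_lt_pi
  · positivity
  · rw [div_lt_iff₀ (by linarith)]
    nlinarith [pi_pos]

theorem two_le_of_ne {i j : B} (h : i ≠ j) (h0 : M i j ≠ 0) : 2 ≤ M i j := by
  have := M.off_diagonal i j h
  omega

theorem rootReflection_isLiftable :
    M.IsLiftable fun i => rootReflection M (simpleRoot i) := by
  intro i j
  by_cases hij : i = j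
  · subst hij
    simp [rootReflection_mul_self (rootForm_simpleRoot_self i)]
  by_cases h0 : M i j = 0
  · simp [h0]
  have h2 := two_le_of_ne hij h0
  have hs := sin_pi_div_pos h2
  have hmθ : (M i j : ℝ) * (π / M i j) = π := by
    field_simp
  set m := M i j with hm
  set θ := π / (m : ℝ) with hθ
  have hii := rootForm_simpleRoot_self (M := M) i
  have hjj := rootForm_simpleRoot_self (M := M) j
  have hij' : rootForm M (simpleRoot i) (simpleRoot j) = -2 * cos θ := rootForm_simpleRoot i j
  have hji' : rootForm M (simpleRoot j) (simpleRoot i) = -2 * cos θ := by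
    rw [rootForm_comm, hij']
  set A := rootReflection M (simpleRoot i) * rootReflection M (simpleRoot j) with hA
  have hA1 : ∀ v, A v = v - (rootForm M (simpleRoot j) v) • simpleRoot j
      - (rootForm M (simpleRoot i) v + 2 * cos θ * rootForm M (simpleRoot j) v)
        • simpleRoot i := by
    intro v
    simp only [hA, Module.End.mul_apply, rootReflection_apply, map_sub, map_smul, hij']
    module
  have key : ∀ k : ℕ,
      sin θ • (A ^ k) (simpleRoot i) =
        sin ((2 * k + 1 : ℕ) * θ) • simpleRoot i + sin ((2 * k : ℕ) * θ) • simpleRoot j ∧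
      sin θ • (A ^ k) (simpleRoot j) =
        -sin ((2 * k : ℕ) * θ) • simpleRoot i
          + (sin ((2 * k + 1 : ℕ) * θ) - 2 * cos θ * sin ((2 * k : ℕ) * θ)) • simpleRoot j := by
    intro k
    induction k with
    | zero => simp
    | succ k ih =>
      have e1 := two_cos_mul_sin θ (2 * k)
      have e2 := two_cos_mul_sin θ (2 * k + 1)
      have e3 : 2 * (k + 1) = 2 * k + 2 := by ring
      have e4 : 2 * k + 2 + 1 = 2 * k + 1 + 2 := by ring
      have e5 : 2 * k + 1 + 1 = 2 * k + 2 := by ring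
      rw [e3, e4]
      rw [e5] at e2
      have f3 : sin ((2 * k + 1 + 2 : ℕ) * θ) =
        2 * cos θ * sin ((2 * k + 2 : ℕ) * θ) - sin ((2 * k + 1 : ℕ) * θ) := by linarith
      have f2 : sin ((2 * k + 2 : ℕ) * θ) =
        2 * cos θ * sin ((2 * k + 1 : ℕ) * θ) - sin ((2 * k : ℕ) * θ) := by linarith
      have hstep : ∀ v, sin θ • (A ^ (k + 1)) v = A (sin θ • (A ^ k) v) := by
        intro v
        rw [pow_succ', Module.End.mul_apply, map_smul]
      rw [hstep, hstep, ih.1, ih.2, f3, f2]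
      constructor
      · simp only [hA1, map_add, map_smul, hii, hjj, hij', hji', smul_eq_mul]
        module
      · simp only [hA1, map_add, map_smul, hii, hjj, hij', hji', smul_eq_mul]
        module
  have hpi : ((2 * m : ℕ) : ℝ) * θ = 2 * π := by push_cast; linear_combination 2 * hmθ
  have hpi' : ((2 * m + 1 : ℕ) : ℝ) * θ = θ + 2 * π := by push_cast; linear_combination 2 * hmθ
  have ki : (A ^ m) (simpleRoot i) = simpleRoot i := by
    have := (key m).1
    rw [hpi, hpi', sin_add_two_pi, sin_two_pi, zero_smul, add_zero] at this
    exact smul_right_injective _ hs.ne' this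
  have kj : (A ^ m) (simpleRoot j) = simpleRoot j := by
    have := (key m).2
    rw [hpi, hpi', sin_add_two_pi, sin_two_pi, mul_zero, neg_zero, zero_smul, zero_add, sub_zero]
      at this
    exact smul_right_injective _ hs.ne' this
  -- Every vector differs from one orthogonal to both simple roots by an element of their span.
  refine LinearMap.ext fun v => ?_
  set p := rootForm M (simpleRoot i) v
  set q := rootForm M (simpleRoot j) v
  set a := (p + cos θ * q) / (2 * sin θ ^ 2) with ha
  set b := (q + cos θ * p) / (2 * sin θ ^ 2) with hb
  have hcs := sin_sq_add_cos_sq θ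
  have h1 : rootForm M (simpleRoot i) (v - a • simpleRoot i - b • simpleRoot j) = 0 := by
    simp only [map_sub, map_smul, hii, hij', smul_eq_mul, ha, hb]
    change p - _ - _ = 0
    field_simp
    linear_combination p * hcs
  have h2 : rootForm M (simpleRoot j) (v - a • simpleRoot i - b • simpleRoot j) = 0 := by
    simp only [map_sub, map_smul, hjj, hji', smul_eq_mul, ha, hb]
    change q - _ - _ = 0
    field_simp
    linear_combination q * hcs
  have h3 : (A ^ m) (v - a • simpleRoot i - b • simpleRoot j) =
      v - a • simpleRoot i - b • simpleRoot j := by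
    have : A (v - a • simpleRoot i - b • simpleRoot j) =
      v - a • simpleRoot i - b • simpleRoot j := by rw [hA1, h1, h2]; simp
    rw [Module.End.pow_apply]
    exact Function.IsFixedPt.iterate this m
  simpa only [map_sub, map_smul, ki, kj, sub_left_inj, Module.End.one_apply] using h3

variable (cs : CoxeterSystem M W)

local prefix:100 "s" => cs.simple
local prefix:100 "ℓ" => cs.length

/-- The geometric representation of a Coxeter group on `B →₀ ℝ`. -/
noncomputable def geomRep : W →* Module.End ℝ (B →₀ ℝ) :=
  cs.lift ⟨_, rootReflection_isLiftable⟩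

theorem geomRep_simple (i : B) : cs.geomRep (s i) = rootReflection M (simpleRoot i) :=
  cs.lift_apply_simple rootReflection_isLiftable i

theorem geomRep_mul_apply (x y : W) (v : B →₀ ℝ) :
    cs.geomRep (x * y) v = cs.geomRep x (cs.geomRep y v) := by
  rw [map_mul, Module.End.mul_apply]

theorem geomRep_apply_inv_self (x : W) (v : B →₀ ℝ) :
    cs.geomRep x (cs.geomRep x⁻¹ v) = v := by
  rw [← geomRep_mul_apply, mul_inv_cancel, map_one, Module.End.one_apply]

theorem geomRep_simple_simpleRoot_self (i : B) :
    cs.geomRep (s i) (simpleRoot i) = -simpleRoot i := by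
  rw [geomRep_simple, rootReflection_apply, rootForm_simpleRoot_self]
  module

theorem rootForm_geomRep (x : W) (v w : B →₀ ℝ) :
    rootForm M (cs.geomRep x v) (cs.geomRep x w) = rootForm M v w := by
  induction x using cs.simple_induction_left with
  | one => simp
  | mul_simple_left x i ih =>
    rw [geomRep_mul_apply, geomRep_mul_apply, geomRep_simple, ← ih]
    simp only [rootReflection_apply, map_sub, map_smul, LinearMap.sub_apply, LinearMap.smul_apply,
      rootForm_simpleRoot_self, smul_eq_mul]
    rw [rootForm_comm (cs.geomRep x v) (simpleRoot i)]
    ring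

/-- An alternating word maps the simple root it does not end in to a combination of the two
simple roots whose coefficients are consecutive values of `sin (k θ) / sin θ`, with
`θ = π / M i j`. -/
theorem geomRep_alternatingWord (i j : B) (k : ℕ) :
    sin (π / M i j) • cs.geomRep (cs.wordProd (alternatingWord i j k)) (simpleRoot i) =
      if Even k then
        sin ((k + 1 : ℕ) * (π / M i j)) • simpleRoot i + sin (k * (π / M i j)) • simpleRoot j
      else
        sin (k * (π / M i j)) • simpleRoot i + sin ((k + 1 : ℕ) * (π / M i j)) • simpleRoot j := by
  have hii := rootForm_simpleRoot_self (M := M) i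
  have hjj := rootForm_simpleRoot_self (M := M) j
  have hij' : rootForm M (simpleRoot i) (simpleRoot j) = -2 * cos (π / M i j) :=
    rootForm_simpleRoot i j
  have hji' : rootForm M (simpleRoot j) (simpleRoot i) = -2 * cos (π / M i j) := by
    rw [rootForm_comm, hij']
  induction k with
  | zero => simp [alternatingWord]
  | succ k ih =>
    have e := two_cos_mul_sin (π / M i j) k
    have e' : sin ((k + 1 + 1 : ℕ) * (π / M i j)) =
      2 * cos (π / M i j) * sin ((k + 1 : ℕ) * (π / M i j)) - sin (k * (π / M i j)) := by
      linarith
    rw [alternatingWord_succ', wordProd_cons, geomRep_mul_apply, ← map_smul, ih, e']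
    by_cases hk : Even k
    · have hk' : ¬ Even (k + 1) := by simpa [Nat.even_add_one] using hk
      simp only [hk, hk', if_true, if_false, geomRep_simple, rootReflection_apply, map_add,
        map_smul, hjj, hji']
      module
    · have hk' : Even (k + 1) := by simpa [Nat.even_add_one] using hk
      simp only [hk, hk', if_true, if_false, geomRep_simple, rootReflection_apply, map_add,
        map_smul, hii, hij']
      module

theorem sin_mul_pi_div_nonneg {k m : ℕ} (hm : 2 ≤ m) (hk : k ≤ m) : 0 ≤ sin (k * (π / m)) := by
  have hm' : (0 : ℝ) < m := by positivity
  have hk' : (k : ℝ) ≤ m := by exact_mod_cast hk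
  apply sin_nonneg_of_nonneg_of_le_pi
  · positivity
  · rw [← mul_div_assoc, div_le_iff₀ hm']
    nlinarith [pi_pos]

/-- If `ℓ(w sᵢ) > ℓ(w)` then `w αᵢ` is a nonnegative combination of simple roots. The proof strips
from `w` on the right an alternating word in `sᵢ, sⱼ`, for a descent `j` of `w`, for as long as the
length drops; what remains has neither descent, so the induction applies to it. The word has fewer
than `M i j` letters, by the braid relation, so that it acts on `αᵢ` with nonnegative coefficients.
-/
theorem geomRep_simpleRoot_nonneg (hM : ∀ i j, M i j ≠ 0) {w : W} {i : B}
    (h : ℓ w < ℓ (w * s i)) (b : B) : 0 ≤ cs.geomRep w (simpleRoot i) b := by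
  induction hn : ℓ w using Nat.strong_induction_on generalizing w i b with
  | _ n IH =>
  subst hn
  by_cases hw : w = 1
  · subst hw
    simp only [map_one, Module.End.one_apply]
    exact Finsupp.single_nonneg.2 zero_le_one b
  obtain ⟨j, hj⟩ := cs.exists_rightDescent_of_ne_one hw
  have hij : i ≠ j := by
    rintro rfl
    exact absurd h (not_lt.2 (le_of_lt hj))
  have h2 := two_le_of_ne hij (hM i j)
  have hs := sin_pi_div_pos h2
  let v : ℕ → W := fun k => w * (cs.wordProd (alternatingWord i j k))⁻¹
  have hv0 : v 0 = w := by simp [v, alternatingWord]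
  have hvw : ∀ k, w = v k * cs.wordProd (alternatingWord i j k) := by simp [v]
  have hvs : ∀ k, v (k + 1) = v k * s (if Even k then j else i) := by
    intro k
    simp only [v, alternatingWord_succ', wordProd_cons, mul_inv_rev, inv_simple, mul_assoc]
  have hlow : ∀ k, ℓ w ≤ ℓ (v k) + k := by
    intro k
    conv_lhs => rw [hvw k]
    refine (cs.length_mul_le _ _).trans ?_
    gcongr
    simpa using cs.length_wordProd_le (alternatingWord i j k)
  have hbraid : ℓ (v (M i j)) + M i j ≠ ℓ w := by
    intro hP
    have e1 : cs.wordProd (alternatingWord i j (M i j)) =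
        cs.wordProd (alternatingWord i j (M i j - 1)) * s i := by
      have : cs.wordProd (alternatingWord i j (M i j)) =
          cs.wordProd (alternatingWord j i (M j i)) :=
        cs.wordProd_braidWord_eq i j
      rw [this, M.symmetric j i]
      obtain ⟨m, hm⟩ : ∃ m, M i j = m + 1 := ⟨M i j - 1, by omega⟩
      rw [hm, alternatingWord_succ, wordProd_concat]
      rfl
    have e2 : w * s i = v (M i j) * cs.wordProd (alternatingWord i j (M i j - 1)) := by
      conv_lhs => rw [hvw (M i j), e1]
      simp [mul_assoc]
    have e3 := cs.length_mul_le (v (M i j)) (cs.wordProd (alternatingWord i j (M i j - 1)))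
    have e4 := cs.length_wordProd_le (alternatingWord i j (M i j - 1))
    rw [length_alternatingWord] at e4
    rw [← e2] at e3
    omega
  have hex : ∃ k, ℓ (v (k + 1)) + (k + 1) ≠ ℓ w :=
    ⟨M i j - 1, by rwa [Nat.sub_add_cancel (by omega)]⟩
  classical
  obtain ⟨k, hk, hmin⟩ : ∃ k, ℓ (v (k + 1)) + (k + 1) ≠ ℓ w ∧
      ∀ k' ≤ k, ℓ (v k') + k' = ℓ w := by
    refine ⟨Nat.find hex, Nat.find_spec hex, fun k' hk' => ?_⟩
    rcases k' with _ | k'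
    · rw [hv0]; rfl
    · exact not_not.1 (Nat.find_min hex hk')
  have hkm : k < M i j := by
    by_contra! hc
    exact hbraid (hmin _ hc)
  have hk0 : k ≠ 0 := by
    rintro rfl
    have h1 : v 1 = w * s j := by rw [hvs 0, hv0]; simp
    rw [zero_add, h1] at hk
    exact hk ((cs.isRightDescent_iff).1 hj)
  obtain ⟨k, rfl⟩ : ∃ k', k = k' + 1 := ⟨k - 1, by omega⟩
  have hPk := hmin (k + 1) le_rfl
  have hnext : ℓ (v (k + 1)) < ℓ (v (k + 1) * s (if Even (k + 1) then j else i)) := by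
    rw [← hvs]
    have h1 := hlow (k + 1 + 1)
    have h3 := cs.length_mul_simple_ne (v (k + 1)) (if Even (k + 1) then j else i)
    rw [← hvs] at h3
    omega
  have hprev : ℓ (v (k + 1)) < ℓ (v (k + 1) * s (if Even k then j else i)) := by
    have e : v (k + 1) * s (if Even k then j else i) = v k := by
      rw [hvs]; simp
    have := hmin k (by omega)
    rw [e]
    omega
  have hpos : ∀ c, 0 ≤ cs.geomRep (v (k + 1)) (simpleRoot i) c ∧
      0 ≤ cs.geomRep (v (k + 1)) (simpleRoot j) c := by
    intro c
    have hlt : ℓ (v (k + 1)) < ℓ w := by omega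
    by_cases hE : Even k
    · have hE' : ¬ Even (k + 1) := by simpa [Nat.even_add_one] using hE
      simp only [hE, hE', if_true, if_false] at hnext hprev
      exact ⟨IH _ hlt hnext c rfl, IH _ hlt hprev c rfl⟩
    · have hE' : Even (k + 1) := by simpa [Nat.even_add_one] using hE
      simp only [hE, hE', if_true, if_false] at hnext hprev
      exact ⟨IH _ hlt hprev c rfl, IH _ hlt hnext c rfl⟩
  have e1 : sin (π / M i j) * cs.geomRep w (simpleRoot i) b =
      cs.geomRep (v (k + 1)) (sin (π / M i j) •
        cs.geomRep (cs.wordProd (alternatingWord i j (k + 1))) (simpleRoot i)) b := by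
    conv_lhs => rw [hvw (k + 1), geomRep_mul_apply]
    rw [map_smul, Finsupp.smul_apply, smul_eq_mul]
  have n1 := sin_mul_pi_div_nonneg h2 hkm.le
  have n2 := sin_mul_pi_div_nonneg h2 (Nat.succ_le_of_lt hkm)
  refine nonneg_of_mul_nonneg_right (a := sin (π / M i j)) ?_ hs
  rw [e1, geomRep_alternatingWord]
  obtain ⟨p1, p2⟩ := hpos b
  split_ifs
  all_goals
    simp only [map_add, map_smul, Finsupp.add_apply, Finsupp.smul_apply, smul_eq_mul]
    exact add_nonneg (mul_nonneg (by assumption) p1) (mul_nonneg (by assumption) p2)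

end GeometricRepresentation

end CoxeterSystem

/-! ### Reflections, exchange and coplanar roots -/

namespace CoxeterSystem

section Roots

variable {B W : Type*} [Group W] {M : CoxeterMatrix B} (cs : CoxeterSystem M W)

local prefix:100 "s" => cs.simple
local prefix:100 "ℓ" => cs.length

theorem rootReflection_smul {n : B →₀ ℝ} {c : ℝ} (hc : c * c = 1) :
    rootReflection M (c • n) = rootReflection M n := by
  refine LinearMap.ext fun v => ?_
  simp only [rootReflection_apply, map_smul, LinearMap.smul_apply, smul_eq_mul, smul_smul]
  rw [mul_right_comm, hc, one_mul]

/-- Vectors of square length `2` on the same line define the same reflection. -/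
theorem rootReflection_eq_of_eq_smul {a b : B →₀ ℝ} (ha : rootForm M a a = 2)
    (hb : rootForm M b b = 2) {c : ℝ} (h : a = c • b) :
    rootReflection M a = rootReflection M b := by
  subst h
  apply rootReflection_smul
  simp only [map_smul, LinearMap.smul_apply, smul_eq_mul, hb] at ha
  linarith

theorem geomRep_conj {t : W} {n : B →₀ ℝ} (h : cs.geomRep t = rootReflection M n) (x : W) :
    cs.geomRep (x * t * x⁻¹) = rootReflection M (cs.geomRep x n) := by
  refine LinearMap.ext fun v => ?_
  rw [geomRep_mul_apply, geomRep_mul_apply, h, rootReflection_apply, rootReflection_apply,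
    map_sub, map_smul, geomRep_apply_inv_self, ← cs.rootForm_geomRep x n,
    geomRep_apply_inv_self]

theorem rootForm_geomRep_simpleRoot_self (w : W) (i : B) :
    rootForm M (cs.geomRep w (simpleRoot i)) (cs.geomRep w (simpleRoot i)) = 2 := by
  rw [rootForm_geomRep, rootForm_simpleRoot_self]

theorem geomRep_simpleRoot_nonpos (hM : ∀ i j, M i j ≠ 0) {w : W} {i : B}
    (h : ℓ (w * s i) < ℓ w) (b : B) : cs.geomRep w (simpleRoot i) b ≤ 0 := by
  have := cs.geomRep_simpleRoot_nonneg hM (w := w * s i) (i := i) (by simpa using h) b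
  rw [geomRep_mul_apply, geomRep_simple_simpleRoot_self, map_neg, Finsupp.neg_apply] at this
  linarith

/-- Every root is either nonnegative or nonpositive. -/
theorem geomRep_simpleRoot_sign (hM : ∀ i j, M i j ≠ 0) (w : W) (i : B) :
    (∀ b, 0 ≤ cs.geomRep w (simpleRoot i) b) ∨ ∀ b, cs.geomRep w (simpleRoot i) b ≤ 0 := by
  rcases lt_or_gt_of_ne (cs.length_mul_simple_ne w i) with h | h
  · exact Or.inr (cs.geomRep_simpleRoot_nonpos hM h)
  · exact Or.inl (cs.geomRep_simpleRoot_nonneg hM h)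

/-- The geometric representation is faithful. -/
theorem geomRep_injective (hM : ∀ i j, M i j ≠ 0) : Function.Injective cs.geomRep := by
  rw [injective_iff_map_eq_one]
  intro w hw
  by_contra hne
  obtain ⟨i, hi⟩ := cs.exists_rightDescent_of_ne_one hne
  have := cs.geomRep_simpleRoot_nonpos hM hi i
  rw [hw] at this
  simp only [Module.End.one_apply, Finsupp.single_eq_same] at this
  linarith

/-- A simple reflection permutes the positive roots other than its own simple root. -/
theorem eq_simpleRoot_of_sign_change {γ : B →₀ ℝ} (hγ : rootForm M γ γ = 2) {i : B}
    (h₁ : ∀ b, 0 ≤ γ b) (h₂ : ∀ b, cs.geomRep (s i) γ b ≤ 0) : γ = simpleRoot i := by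
  have h : γ = γ i • simpleRoot i := by
    ext b
    by_cases hb : b = i
    · subst hb; simp
    · have := h₂ b
      rw [geomRep_simple, rootReflection_apply] at this
      have hbi : (simpleRoot i : B →₀ ℝ) b = 0 := Finsupp.single_eq_of_ne hb
      simp only [Finsupp.sub_apply, Finsupp.smul_apply, hbi, smul_zero, sub_zero] at this ⊢
      exact le_antisymm this (h₁ b)
  have h3 : γ i * γ i = 1 := by
    rw [h] at hγ
    simp only [map_smul, LinearMap.smul_apply, smul_eq_mul, rootForm_simpleRoot_self] at hγ
    have : (γ i • simpleRoot i) i = γ i := by rw [← h]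
    linarith
  have h4 : γ i = 1 := by nlinarith [h₁ i]
  rw [h, h4, one_smul]

/-- Every reflection acts as the orthogonal reflection along a positive root. -/
theorem IsReflection.exists_root (hM : ∀ i j, M i j ≠ 0) {t : W} (ht : cs.IsReflection t) :
    ∃ w i, (∀ b, 0 ≤ cs.geomRep w (simpleRoot i) b) ∧
      cs.geomRep t = rootReflection M (cs.geomRep w (simpleRoot i)) := by
  obtain ⟨w, i, rfl⟩ := ht
  rcases cs.geomRep_simpleRoot_sign hM w i with h | h
  · exact ⟨w, i, h, cs.geomRep_conj (cs.geomRep_simple i) w⟩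
  · refine ⟨w * s i, i, fun b => ?_, ?_⟩
    · rw [geomRep_mul_apply, geomRep_simple_simpleRoot_self, map_neg, Finsupp.neg_apply]
      exact neg_nonneg.2 (h b)
    · have := cs.geomRep_conj (cs.geomRep_simple i) (w * s i)
      simpa [mul_assoc] using this

theorem IsReflection.exists_norm_two (hM : ∀ i j, M i j ≠ 0) {t : W} (ht : cs.IsReflection t) :
    ∃ n, rootForm M n n = 2 ∧ cs.geomRep t = rootReflection M n := by
  obtain ⟨w, i, -, h⟩ := IsReflection.exists_root cs hM ht
  exact ⟨_, cs.rootForm_geomRep_simpleRoot_self w i, h⟩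

theorem eq_conj_of_geomRep_eq (hM : ∀ i j, M i j ≠ 0) {t x y : W} {i j : B}
    (ht : cs.geomRep t = rootReflection M (cs.geomRep x (simpleRoot i)))
    (h : cs.geomRep (y⁻¹ * x) (simpleRoot i) = simpleRoot j) : t = y * s j * y⁻¹ := by
  apply cs.geomRep_injective hM
  rw [cs.geomRep_conj (cs.geomRep_simple j) y, ht, ← h, ← geomRep_mul_apply, mul_inv_cancel_left]

/-- If `ℓ(t p) > ℓ(p)` for the reflection `t` along the positive root `β`, then `p⁻¹ β` is
positive. -/
theorem geomRep_inv_root_nonneg (hM : ∀ i j, M i j ≠ 0) {t x : W} {i : B}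
    (hβ : ∀ b, 0 ≤ cs.geomRep x (simpleRoot i) b)
    (ht : cs.geomRep t = rootReflection M (cs.geomRep x (simpleRoot i))) {p : W}
    (h : ℓ p < ℓ (t * p)) : ∀ b, 0 ≤ cs.geomRep (p⁻¹ * x) (simpleRoot i) b := by
  induction hn : ℓ p generalizing p with
  | zero =>
    obtain rfl := cs.length_eq_zero_iff.1 hn
    simpa using hβ
  | succ n ih =>
    have hp : p ≠ 1 := by
      rintro rfl
      simp at hn
    obtain ⟨j, hj⟩ := cs.exists_rightDescent_of_ne_one hp
    rw [cs.isRightDescent_iff] at hj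
    have h1 : ℓ (p * s j) < ℓ (t * (p * s j)) := by
      have := cs.length_mul_simple (t * p) j
      rw [mul_assoc] at this
      omega
    refine (cs.geomRep_simpleRoot_sign hM _ _).resolve_right fun hneg => ?_
    have hroot : cs.geomRep ((p * s j)⁻¹ * x) (simpleRoot i) = simpleRoot j := by
      refine cs.eq_simpleRoot_of_sign_change (cs.rootForm_geomRep_simpleRoot_self _ i)
        (ih h1 (by omega)) fun b => ?_
      rw [← geomRep_mul_apply, ← mul_assoc, mul_inv_rev, inv_simple, ← mul_assoc,
        simple_mul_simple_self, one_mul]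
      exact hneg b
    have htp : t * p = p * s j := by
      rw [cs.eq_conj_of_geomRep_eq hM ht hroot]
      simp [mul_assoc]
    rw [htp] at h
    omega

/-- The strong exchange property, in the form of the lifting property for edges of the Bruhat graph:
right multiplication by a simple reflection preserves the direction of every edge `p → q` other than
`p → p s`. -/
theorem BruhatStep.mul_simple (hM : ∀ i j, M i j ≠ 0) {p q : W} (h : cs.BruhatStep p q) {j : B}
    (hne : q ≠ p * s j) : cs.BruhatStep (p * s j) (q * s j) := by
  obtain ⟨t, ht, rfl, hlt⟩ := h
  refine ⟨t, ht, mul_assoc _ _ _, ?_⟩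
  by_contra hcon
  have hle := lt_of_le_of_ne (not_lt.1 hcon) (by rw [mul_assoc]; exact ht.length_mul_right_ne _)
  obtain ⟨x, i, hβ, hx⟩ := IsReflection.exists_root cs hM ht
  have h1 := cs.geomRep_inv_root_nonneg hM hβ hx hlt
  have h2 : ∀ b, 0 ≤ cs.geomRep ((t * p * s j)⁻¹ * x) (simpleRoot i) b := by
    refine cs.geomRep_inv_root_nonneg hM hβ hx (hle.trans_eq ?_)
    rw [← mul_assoc, ← mul_assoc, ht.mul_self, one_mul]
  refine hne ?_
  have h3 : cs.geomRep (p⁻¹ * x) (simpleRoot i) = simpleRoot j := by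
    refine cs.eq_simpleRoot_of_sign_change (cs.rootForm_geomRep_simpleRoot_self _ i) h1 fun b => ?_
    have e : cs.geomRep ((t * p * s j)⁻¹ * x) (simpleRoot i) =
        -cs.geomRep (s j) (cs.geomRep (p⁻¹ * x) (simpleRoot i)) := by
      rw [mul_inv_rev, mul_inv_rev, inv_simple, ht.inv, mul_assoc, mul_assoc, geomRep_mul_apply,
        geomRep_mul_apply, geomRep_mul_apply, hx, rootReflection_apply,
        rootForm_geomRep_simpleRoot_self, geomRep_mul_apply, ← map_neg, ← map_neg]
      congr 2
      module
    have := h2 b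
    rw [e, Finsupp.neg_apply] at this
    linarith
  rw [cs.eq_conj_of_geomRep_eq hM hx h3]
  simp [mul_assoc]

/-- An element acting as an orthogonal reflection is a reflection. If conjugation by `sᵢ`, for a
descent `i` of `w`, does not shorten `w`, then `w` sends the simple root `αᵢ` to its negative, so
that the reflecting vector is proportional to `αᵢ`. -/
theorem isReflection_of_geomRep_eq (hM : ∀ i j, M i j ≠ 0) {w : W} {n : B →₀ ℝ}
    (hn : rootForm M n n = 2) (h : cs.geomRep w = rootReflection M n) : cs.IsReflection w := by
  induction hl : ℓ w using Nat.strong_induction_on generalizing w n with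
  | _ k IH =>
  subst hl
  have hww : w * w = 1 := by
    apply cs.geomRep_injective hM
    rw [map_mul, h, rootReflection_mul_self hn, map_one]
  have hinv : w⁻¹ = w := inv_eq_of_mul_eq_one_left hww
  have hw : w ≠ 1 := by
    rintro rfl
    have h0 : n = -n := by
      conv_lhs => rw [← Module.End.one_apply (R := ℝ) n, ← map_one cs.geomRep, h,
        rootReflection_apply, hn]
      module
    simp [self_eq_neg.1 h0] at hn
  obtain ⟨i, hi⟩ := cs.exists_rightDescent_of_ne_one hw
  by_cases hlt : ℓ (s i * w * s i) < ℓ w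
  · have hrefl : cs.IsReflection (s i * w * (s i)⁻¹) := by
      refine IH _ ?_ (n := cs.geomRep (s i) n) ?_ ?_ rfl
      · rwa [inv_simple]
      · rw [rootForm_geomRep, hn]
      · exact cs.geomRep_conj h (s i)
    exact (cs.isReflection_conj_iff _ _).1 hrefl
  · have hneg := cs.geomRep_simpleRoot_nonpos hM hi
    have hlt' : ℓ (w * s i) < ℓ (s i * w * s i) := lt_of_lt_of_le hi (not_lt.1 hlt)
    have hpos : ∀ b, 0 ≤ cs.geomRep (s i * w) (simpleRoot i) b := by
      refine cs.geomRep_simpleRoot_nonneg hM ?_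
      have e : ℓ (s i * w) = ℓ (w * s i) := by
        rw [← length_inv, mul_inv_rev, hinv, inv_simple]
      rwa [e]
    have hroot : -cs.geomRep w (simpleRoot i) = simpleRoot i := by
      refine cs.eq_simpleRoot_of_sign_change (i := i) ?_ (fun b => ?_) fun b => ?_
      · simpa using cs.rootForm_geomRep_simpleRoot_self w i
      · rw [Finsupp.neg_apply]
        exact neg_nonneg.2 (hneg b)
      · rw [map_neg, ← geomRep_mul_apply, Finsupp.neg_apply]
        exact neg_nonpos.2 (hpos b)
    rw [h, rootReflection_apply] at hroot
    set κ := rootForm M n (simpleRoot i) with hκ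
    have h2 : (2 : ℝ) • simpleRoot i = κ • n := by
      have : κ • n = simpleRoot i + simpleRoot i := by
        nth_rewrite 1 [← hroot]
        module
      rw [this]
      module
    have h3 : simpleRoot i = (κ / 2) • n := by
      rw [div_eq_inv_mul, mul_smul, ← h2, smul_smul]
      norm_num
    have h4 : w = s i := by
      apply cs.geomRep_injective hM
      rw [h, geomRep_simple]
      exact (rootReflection_eq_of_eq_smul (rootForm_simpleRoot_self i) hn h3).symm
    rw [h4]
    exact cs.isReflection_simple i

/-- The product of the reflections along three coplanar vectors of square length `2` is the
reflection along an explicit vector of the same plane. -/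
theorem rootReflection_mul_mul_of_coplanar {a b : B →₀ ℝ} (ha : rootForm M a a = 2)
    (hb : rootForm M b b = 2) {x y : ℝ} (hc : rootForm M (x • a + y • b) (x • a + y • b) = 2) :
    ∃ n, rootForm M n n = 2 ∧
      rootReflection M a * rootReflection M b * rootReflection M (x • a + y • b) =
        rootReflection M n := by
  have hba : rootForm M b a = rootForm M a b := rootForm_comm b a
  -- In complex coordinates on the plane, with unit vectors, this is `a b⁻¹ c`.
  refine ⟨(x * rootForm M a b + y) • a - x • b, ?_, LinearMap.ext fun v => ?_⟩
  · simp only [map_add, map_sub, map_smul, LinearMap.add_apply, LinearMap.sub_apply,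
      LinearMap.smul_apply, smul_eq_mul, ha, hb, hba] at hc ⊢
    linear_combination hc
  · simp only [Module.End.mul_apply, rootReflection_apply, map_add, map_sub, map_smul,
      LinearMap.add_apply, LinearMap.sub_apply, LinearMap.smul_apply, smul_eq_mul, ha, hb, hba]
      at hc ⊢
    set k := rootForm M a b
    set p := rootForm M a v
    set q := rootForm M b v
    match_scalars
    · ring
    · linear_combination ((p - q * k) / 2) * hc
    · linear_combination (q / 2) * hc

/-- For a finite Coxeter group the form is nondegenerate: a vector in its radical is fixed by the
group, while the sum of all group elements acts as `0`. -/
theorem eq_zero_of_rootForm_eq_zero (cs : CoxeterSystem M W) [Finite W] {n : B →₀ ℝ}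
    (hn : ∀ v, rootForm M v n = 0) : n = 0 := by
  have := Fintype.ofFinite W
  have hfix : ∀ w, cs.geomRep w n = n := by
    intro w
    induction w using cs.simple_induction_left with
    | one => simp
    | mul_simple_left x i ih =>
      rw [geomRep_mul_apply, ih, geomRep_simple, rootReflection_apply, hn, zero_smul, sub_zero]
  have hsum : ∑ w, cs.geomRep w = 0 := by
    refine Finsupp.lhom_ext' fun i => LinearMap.ext_ring ?_
    have h : ∑ w, cs.geomRep w (simpleRoot i) = -∑ w, cs.geomRep w (simpleRoot i) := by
      conv_lhs => rw [← Equiv.sum_comp (Equiv.mulRight (cs.simple i))]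
      rw [← Finset.sum_neg_distrib]
      refine Finset.sum_congr rfl fun w _ => ?_
      rw [Equiv.coe_mulRight, geomRep_mul_apply, geomRep_simple_simpleRoot_self, map_neg]
    simpa [LinearMap.sum_apply] using self_eq_neg.1 h
  have h := congrArg (fun f : Module.End ℝ (B →₀ ℝ) => f n) hsum
  simp only [LinearMap.sum_apply, hfix, Finset.sum_const, LinearMap.zero_apply] at h
  exact (smul_eq_zero.1 h).resolve_left (by simp)

/-- A nontrivial product of two reflections determines the plane spanned by their roots: the second
root `d` of any other factorization into two reflections lies in that plane, because a vector
orthogonal to `a` and `b` is fixed by the product and so is orthogonal to `d`. -/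
theorem mem_plane_of_rootReflection_mul_eq
    (hnd : ∀ n : B →₀ ℝ, (∀ v, rootForm M v n = 0) → n = 0) {a b c d : B →₀ ℝ}
    (hc : rootForm M c c = 2) (hd : rootForm M d d = 2)
    (h : rootReflection M a * rootReflection M b = rootReflection M c * rootReflection M d)
    (h1 : rootReflection M a * rootReflection M b ≠ 1) :
    ∃ x y : ℝ, d = x • a + y • b := by
  have hker : ∀ v, rootForm M a v = 0 → rootForm M b v = 0 → rootForm M d v = 0 := by
    intro v hav hbv
    by_contra hdv
    have e1 : rootReflection M c (rootReflection M d v) = v := by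
      rw [← Module.End.mul_apply, ← h, Module.End.mul_apply, rootReflection_apply b, hbv,
        zero_smul, sub_zero, rootReflection_apply, hav, zero_smul, sub_zero]
    have e2 : rootReflection M d v = rootReflection M c v := by
      conv_rhs => rw [← e1, ← Module.End.mul_apply, rootReflection_mul_self hc]
      rfl
    have e3 : rootForm M d v • d = rootForm M c v • c := by
      simpa [rootReflection_apply] using e2
    have e4 : d = ((rootForm M d v)⁻¹ * rootForm M c v) • c := by
      rw [mul_smul, ← e3, smul_smul, inv_mul_cancel₀ hdv, one_smul]
    apply h1
    rw [h, rootReflection_eq_of_eq_smul hd hc e4, rootReflection_mul_self hc]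
  have hmem : rootForm M d ∈ Submodule.span ℝ (Set.range ![rootForm M a, rootForm M b]) := by
    apply mem_span_of_iInf_ker_le_ker
    intro v hv
    simp only [Submodule.mem_iInf, LinearMap.mem_ker, Fin.forall_fin_two, Matrix.cons_val_zero,
      Matrix.cons_val_one] at hv
    exact hker v hv.1 hv.2
  rw [Matrix.range_cons, Matrix.range_cons, Matrix.range_empty, Set.union_empty,
    Set.singleton_union, Submodule.mem_span_pair] at hmem
  obtain ⟨x, y, hxy⟩ := hmem
  refine ⟨x, y, sub_eq_zero.1 (hnd _ fun v => ?_)⟩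
  rw [rootForm_comm, map_sub, map_add, map_smul, map_smul, hxy, sub_self, LinearMap.zero_apply]

/-- If `t₁`, `t₂`, `t₃` are reflections, and if `ρ tᵢ` for `i = 1, 2, 3` and `σ tᵢ` for `i = 2, 3`
are reflections, then so is `σ t₁`: all roots involved lie in one plane. -/
theorem isReflection_mul_of_coplanar [Finite W] (hM : ∀ i j, M i j ≠ 0) {t₁ t₂ t₃ ρ σ : W}
    (h₁ : cs.IsReflection t₁) (h₂ : cs.IsReflection t₂) (h₃ : cs.IsReflection t₃)
    (h12 : t₁ ≠ t₂) (h23 : t₂ ≠ t₃) (hρ : ρ ≠ 1)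
    (hρ₁ : cs.IsReflection (ρ * t₁)) (hρ₂ : cs.IsReflection (ρ * t₂))
    (hρ₃ : cs.IsReflection (ρ * t₃)) (hσ₂ : cs.IsReflection (σ * t₂))
    (hσ₃ : cs.IsReflection (σ * t₃)) : cs.IsReflection (σ * t₁) := by
  by_cases hσ : σ = 1
  · rwa [hσ, one_mul]
  have hnd : ∀ n : B →₀ ℝ, (∀ v, rootForm M v n = 0) → n = 0 :=
    fun n => cs.eq_zero_of_rootForm_eq_zero
  have hinj := cs.geomRep_injective hM
  have hprod : ∀ {τ t a b}, cs.IsReflection t → cs.geomRep (τ * t) = rootReflection M a →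
      cs.geomRep t = rootReflection M b →
      rootReflection M a * rootReflection M b = cs.geomRep τ := by
    intro τ t a b ht ha hb
    rw [← ha, ← hb, ← map_mul, mul_assoc, ht.mul_self, mul_one]
  have hne : ∀ {τ}, τ ≠ 1 → cs.geomRep τ ≠ 1 := fun h h' => h (hinj (by rw [h', map_one]))
  obtain ⟨a₁, na₁, ha₁⟩ := IsReflection.exists_norm_two cs hM h₁
  obtain ⟨a₂, na₂, ha₂⟩ := IsReflection.exists_norm_two cs hM h₂
  obtain ⟨a₃, na₃, ha₃⟩ := IsReflection.exists_norm_two cs hM h₃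
  obtain ⟨b₁, -, hb₁⟩ := IsReflection.exists_norm_two cs hM hρ₁
  obtain ⟨b₂, nb₂, hb₂⟩ := IsReflection.exists_norm_two cs hM hρ₂
  obtain ⟨b₃, nb₃, hb₃⟩ := IsReflection.exists_norm_two cs hM hρ₃
  obtain ⟨c₂, nc₂, hc₂⟩ := IsReflection.exists_norm_two cs hM hσ₂
  obtain ⟨c₃, nc₃, hc₃⟩ := IsReflection.exists_norm_two cs hM hσ₃
  have p₁ := hprod h₁ hb₁ ha₁
  have p₂ := hprod h₂ hb₂ ha₂
  have p₃ := hprod h₃ hb₃ ha₃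
  have q₂ := hprod h₂ hc₂ ha₂
  have q₃ := hprod h₃ hc₃ ha₃
  have hp : rootReflection M b₁ * rootReflection M a₁ ≠ 1 := by rw [p₁]; exact hne hρ
  have hq : rootReflection M c₂ * rootReflection M a₂ ≠ 1 := by rw [q₂]; exact hne hσ
  obtain ⟨x, y, hxy⟩ := mem_plane_of_rootReflection_mul_eq hnd nb₂ na₂ (p₁.trans p₂.symm) hp
  obtain ⟨x', y', hxy'⟩ := mem_plane_of_rootReflection_mul_eq hnd nb₃ na₃ (p₁.trans p₃.symm) hp
  obtain ⟨z, w, hzw⟩ := mem_plane_of_rootReflection_mul_eq hnd nc₃ na₃ (q₂.trans q₃.symm) hq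
  have hx : x ≠ 0 := by
    rintro rfl
    rw [zero_smul, zero_add] at hxy
    refine h12 (hinj ?_)
    rw [ha₁, ha₂, rootReflection_eq_of_eq_smul na₂ na₁ hxy]
  have hz : z ≠ 0 := by
    rintro rfl
    rw [zero_smul, zero_add] at hzw
    refine h23 (hinj ?_)
    rw [ha₂, ha₃, rootReflection_eq_of_eq_smul na₃ na₂ hzw]
  have hb : b₁ = x⁻¹ • (a₂ - y • a₁) := by
    rw [hxy, add_sub_cancel_right, smul_smul, inv_mul_cancel₀ hx, one_smul]
  have hc : c₂ = (z⁻¹ * (y' - x' * x⁻¹ * y)) • a₁ + (z⁻¹ * (x' * x⁻¹ - w)) • a₂ := by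
    have : c₂ = z⁻¹ • (a₃ - w • a₂) := by
      rw [hzw, add_sub_cancel_right, smul_smul, inv_mul_cancel₀ hz, one_smul]
    rw [this, hxy', hb]
    module
  rw [hc] at nc₂
  obtain ⟨n, hn, hprod'⟩ := rootReflection_mul_mul_of_coplanar na₁ na₂ nc₂
  have hinv : (σ * t₁)⁻¹ = t₁ * t₂ * (σ * t₂) := by
    rw [← hσ₂.inv, mul_inv_rev, mul_inv_rev, h₁.inv, h₂.inv, mul_assoc, ← mul_assoc t₂,
      h₂.mul_self, one_mul]
  rw [← inv_inv (σ * t₁)]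
  refine IsReflection.isReflection_inv ?_
  refine cs.isReflection_of_geomRep_eq hM hn ?_
  rw [hinv, map_mul, map_mul, ha₁, ha₂, hc₂, hc, hprod']

/-- Reflection adjacency, the edges of the Bruhat graph with the direction forgotten, is determined
inside a complete bipartite graph `K₃,₃` by eight of the nine edges. -/
theorem isReflection_of_bipartite [Finite W] (hM : ∀ i j, M i j ≠ 0) {x c₁ c₂ b₁ b₂ y : W}
    (hxc : x ≠ c₁) (hcc : c₁ ≠ c₂) (hbb : b₁ ≠ b₂)
    (hxb₁ : cs.IsReflection (b₁ * x⁻¹)) (hxb₂ : cs.IsReflection (b₂ * x⁻¹))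
    (hc₁b₁ : cs.IsReflection (b₁ * c₁⁻¹)) (hc₁b₂ : cs.IsReflection (b₂ * c₁⁻¹))
    (hc₂b₁ : cs.IsReflection (b₁ * c₂⁻¹)) (hc₂b₂ : cs.IsReflection (b₂ * c₂⁻¹))
    (hc₁y : cs.IsReflection (y * c₁⁻¹)) (hc₂y : cs.IsReflection (y * c₂⁻¹)) :
    cs.IsReflection (y * x⁻¹) := by
  have e : ∀ u v, v * b₁⁻¹ * (b₁ * u⁻¹) = v * u⁻¹ := fun u v => by group
  rw [← e]
  refine cs.isReflection_mul_of_coplanar hM hxb₁ hc₁b₁ hc₂b₁ ?_ ?_ (ρ := b₂ * b₁⁻¹) ?_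
    (by rwa [e]) (by rwa [e]) (by rwa [e]) (by rwa [e]) (by rwa [e])
  · simpa using hxc
  · simpa using hcc
  · rw [Ne, mul_inv_eq_one]
    exact hbb.symm

end Roots

end CoxeterSystem

/-! ### Paths and crowns in the Bruhat graph -/

namespace CoxeterSystem

section BruhatGraph

variable {B W : Type*} [Group W] {M : CoxeterMatrix B} (cs : CoxeterSystem M W)

local prefix:100 "s" => cs.simple
local prefix:100 "ℓ" => cs.length

variable {cs}

theorem BruhatStep.length_lt {x y : W} (h : cs.BruhatStep x y) : ℓ x < ℓ y := by
  obtain ⟨_, _, _, h⟩ := h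
  exact h

theorem BruhatStep.isReflection {x y : W} (h : cs.BruhatStep x y) :
    cs.IsReflection (y * x⁻¹) := by
  obtain ⟨t, ht, rfl, _⟩ := h
  simpa using ht

theorem isReflection_mul_inv_comm {x y : W} (h : cs.IsReflection (y * x⁻¹)) :
    cs.IsReflection (x * y⁻¹) := by
  have := h.isReflection_inv
  rwa [mul_inv_rev, inv_inv] at this

theorem BruhatStep.isReflection' {x y : W} (h : cs.BruhatStep x y) :
    cs.IsReflection (x * y⁻¹) :=
  isReflection_mul_inv_comm h.isReflection

theorem BruhatStep.of_isReflection {x y : W} (h : cs.IsReflection (y * x⁻¹)) (hl : ℓ x < ℓ y) :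
    cs.BruhatStep x y :=
  ⟨y * x⁻¹, h, by simp, hl⟩

theorem length_ne_of_isReflection {x y : W} (h : cs.IsReflection (y * x⁻¹)) : ℓ x ≠ ℓ y := by
  have := h.length_mul_right_ne x
  simpa using this.symm

theorem BruhatStep.length_mod_two {x y : W} (h : cs.BruhatStep x y) :
    ℓ y % 2 = (ℓ x + 1) % 2 := by
  obtain ⟨t, ht, rfl, _⟩ := h
  have h1 := cs.length_mul_mod_two t x
  have h2 := Nat.odd_iff.1 ht.odd_length
  omega

theorem BruhatStep.le {x y : W} (h : cs.BruhatStep x y) : cs.BruhatLE x y :=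
  Relation.ReflTransGen.single h

theorem BruhatStep.ne {x y : W} (h : cs.BruhatStep x y) : x ≠ y := by
  rintro rfl
  exact lt_irrefl _ h.length_lt

theorem BruhatLE.length_lt_of_ne {x y : W} (h : cs.BruhatLE x y) (hne : x ≠ y) : ℓ x < ℓ y :=
  h.eq_or_length_lt.resolve_left hne

theorem BruhatLE.bruhatStep_of_length_eq {x y : W} (h : cs.BruhatLE x y) (hl : ℓ y = ℓ x + 1) :
    cs.BruhatStep x y := by
  rcases Relation.ReflTransGen.cases_head h with rfl | ⟨c, hc, hcy⟩
  · omega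
  · have h1 := hc.length_lt
    rcases BruhatLE.eq_or_length_lt hcy with rfl | h2
    · exact hc
    · omega

theorem bruhatStep_mul_simple {x : W} {i : B} (h : ℓ x < ℓ (x * s i)) :
    cs.BruhatStep x (x * s i) :=
  .of_isReflection ((cs.isReflection_simple i).conj x) h

theorem mul_simple_bruhatStep {x : W} {i : B} (h : ℓ (x * s i) < ℓ x) :
    cs.BruhatStep (x * s i) x := by
  have := bruhatStep_mul_simple (cs := cs) (x := x * s i) (i := i) (by simpa using h)
  simpa using this

/-- Cancelled form of `BruhatStep.mul_simple`. -/
theorem BruhatStep.of_mul_simple (hM : ∀ i j, M i j ≠ 0) {x q : W} {i : B}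
    (h : cs.BruhatStep (x * s i) q) (hne : q ≠ x) : cs.BruhatStep x (q * s i) := by
  have := h.mul_simple cs hM (j := i) (by simpa using hne)
  simpa using this

/-- Cancelled form of `BruhatStep.mul_simple`. -/
theorem BruhatStep.of_mul_simple' (hM : ∀ i j, M i j ≠ 0) {p y : W} {i : B}
    (h : cs.BruhatStep p (y * s i)) (hne : p ≠ y) : cs.BruhatStep (p * s i) y := by
  have := h.mul_simple cs hM (j := i) (by simpa using hne.symm)
  simpa using this

theorem BruhatStep.exists_descent {x y : W} (h : cs.BruhatStep x y) :
    ∃ i, ℓ (y * s i) + 1 = ℓ y := by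
  have hy : y ≠ 1 := by
    rintro rfl
    have := h.length_lt
    simp at this
  obtain ⟨i, hi⟩ := cs.exists_rightDescent_of_ne_one hy
  exact ⟨i, cs.isRightDescent_iff.1 hi⟩

/-- Directed paths of length two in the Bruhat graph come in pairs. -/
theorem exists_ne_bruhatStep_bruhatStep (hM : ∀ i j, M i j ≠ 0) {x p q : W}
    (hxp : cs.BruhatStep x p) (hpq : cs.BruhatStep p q) :
    ∃ p', p' ≠ p ∧ cs.BruhatStep x p' ∧ cs.BruhatStep p' q := by
  induction hn : ℓ q using Nat.strong_induction_on generalizing x p q with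
  | _ n IH =>
  subst hn
  obtain ⟨i, hi⟩ := hpq.exists_descent
  have l1 := hxp.length_lt
  have l2 := hpq.length_lt
  -- A path from `x s` to `q s` avoiding `x` is carried by right multiplication to one from `x`.
  have hback : ∀ p', p' ≠ p * s i → p' ≠ x → cs.BruhatStep (x * s i) p' →
      cs.BruhatStep p' (q * s i) →
      ∃ p', p' ≠ p ∧ cs.BruhatStep x p' ∧ cs.BruhatStep p' q := by
    intro p' hne hx h1 h2
    refine ⟨p' * s i, ?_, h1.of_mul_simple hM hx, h2.of_mul_simple' hM ?_⟩
    · rintro rfl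
      simp at hne
    · rintro rfl
      have := h2.length_lt
      omega
  rcases cs.length_mul_simple x i with hx | hx
  · by_cases hp : p = x * s i
    · subst hp
      refine ⟨q * s i, ?_, .of_isReflection ?_ (by omega), mul_simple_bruhatStep (by omega)⟩
      · rintro h
        rw [mul_left_injective _ h] at l2
        omega
      · simpa [mul_assoc] using hpq.isReflection
    have h1 := hxp.mul_simple cs hM hp
    by_cases hq : q = p * s i
    · exact ⟨x * s i, Ne.symm hp, bruhatStep_mul_simple (by omega), by rwa [hq]⟩
    obtain ⟨p', hne, h3, h4⟩ := IH (ℓ (q * s i)) (by omega) h1 (hpq.mul_simple cs hM hq) rfl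
    refine hback p' hne ?_ h3 h4
    rintro rfl
    have := h3.length_lt
    omega
  · have hpx : p ≠ x * s i := by
      rintro rfl
      omega
    by_cases hq : q = p * s i
    · have hqp : q * s i = p := by simp [hq]
      obtain ⟨p', hne, h3, h4⟩ := IH (ℓ (q * s i)) (by omega)
        (mul_simple_bruhatStep (x := x) (i := i) (by omega)) (by rwa [hqp]) rfl
      refine hback p' ?_ hne h3 h4
      rintro rfl
      have := h4.length_lt
      rw [← hq] at this
      omega
    · obtain ⟨p', hne, h3, h4⟩ := IH (ℓ (q * s i)) (by omega) (hxp.mul_simple cs hM hpx)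
        (hpq.mul_simple cs hM hq) rfl
      by_cases hp' : p' = x
      · subst hp'
        refine ⟨q * s i, ?_, h4, mul_simple_bruhatStep (by omega)⟩
        rintro rfl
        simp at hq
      · exact hback p' hne hp' h3 h4

/-- An edge of the Bruhat graph that is not a covering relation spans a directed path of length
three. -/
theorem BruhatStep.exists_path (hM : ∀ i j, M i j ≠ 0) {x y : W} (hxy : cs.BruhatStep x y)
    (hl : ℓ x + 3 ≤ ℓ y) :
    ∃ b c, cs.BruhatStep x b ∧ cs.BruhatStep b c ∧ cs.BruhatStep c y := by
  induction hn : ℓ y using Nat.strong_induction_on generalizing x y with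
  | _ n IH =>
  subst hn
  obtain ⟨i, hi⟩ := hxy.exists_descent
  have hys : cs.BruhatStep (y * s i) y := mul_simple_bruhatStep (by omega)
  rcases cs.length_mul_simple x i with hx | hx
  · refine ⟨x * s i, y * s i, bruhatStep_mul_simple (by omega), .of_isReflection ?_ (by omega), hys⟩
    simpa [mul_assoc] using hxy.isReflection
  · have hne : y ≠ x * s i := by
      rintro rfl
      omega
    obtain ⟨b, c, h1, h2, h3⟩ := IH (ℓ (y * s i)) (by omega) (hxy.mul_simple cs hM hne)
      (by omega) rfl
    by_cases hb : b = x
    · subst hb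
      exact ⟨c, y * s i, h2, h3, hys⟩
    have h4 := h1.of_mul_simple hM hb
    by_cases hc : c = b * s i
    · exact ⟨c, y * s i, by rwa [hc], h3, hys⟩
    refine ⟨b * s i, c * s i, h4, h2.mul_simple cs hM hc, h3.of_mul_simple' hM ?_⟩
    rintro rfl
    have := h3.length_lt
    omega

/-- An edge `x → y` of the Bruhat graph that is not a covering relation spans a crown
`x → {b₁, b₂} → {c₁, c₂} → y` of shorter edges. -/
theorem BruhatStep.exists_crown [Finite W] (hM : ∀ i j, M i j ≠ 0) {x y : W}
    (hxy : cs.BruhatStep x y) (hl : ℓ x + 3 ≤ ℓ y) :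
    ∃ b₁ b₂ c₁ c₂, b₁ ≠ b₂ ∧ c₁ ≠ c₂ ∧ cs.BruhatStep x b₁ ∧ cs.BruhatStep x b₂ ∧
      cs.BruhatStep b₁ c₁ ∧ cs.BruhatStep b₁ c₂ ∧ cs.BruhatStep b₂ c₁ ∧ cs.BruhatStep b₂ c₂ ∧
      cs.BruhatStep c₁ y ∧ cs.BruhatStep c₂ y := by
  obtain ⟨b₁, c₁, hxb₁, hb₁c₁, hc₁y⟩ := hxy.exists_path hM hl
  obtain ⟨b₂, hb, hxb₂, hb₂c₁⟩ := exists_ne_bruhatStep_bruhatStep hM hxb₁ hb₁c₁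
  obtain ⟨c₂, hc, hb₁c₂, hc₂y⟩ := exists_ne_bruhatStep_bruhatStep hM hb₁c₁ hc₁y
  have hxc₁ : x ≠ c₁ := by
    rintro rfl
    exact (hxb₁.length_lt.trans hb₁c₁.length_lt).false
  have hxc₂ : x ≠ c₂ := by
    rintro rfl
    exact (hxb₁.length_lt.trans hb₁c₂.length_lt).false
  have hb₁y : b₁ ≠ y := by
    rintro rfl
    exact (hb₁c₁.length_lt.trans hc₁y.length_lt).false
  have hadj : cs.IsReflection (b₂ * c₂⁻¹) :=
    cs.isReflection_of_bipartite hM hxc₂.symm hxc₁ hb₁y hb₁c₂.isReflection'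
      hc₂y.isReflection hxb₁.isReflection hxy.isReflection hb₁c₁.isReflection' hc₁y.isReflection
      hxb₂.isReflection hb₂c₁.isReflection'
  rcases lt_or_gt_of_ne (length_ne_of_isReflection hadj) with hlt | hlt
  -- If `b₂` lies above `c₂`, replace it by a second vertex of a path from `x` to `c₂`.
  · obtain ⟨b₃, hb', hxb₃, hb₃c₂⟩ := exists_ne_bruhatStep_bruhatStep hM hxb₁ hb₁c₂
    have hadj' : cs.IsReflection (b₃ * c₁⁻¹) :=
      cs.isReflection_of_bipartite hM hxc₁.symm hxc₂ hb₁y hb₁c₁.isReflection'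
        hc₁y.isReflection hxb₁.isReflection hxy.isReflection hb₁c₂.isReflection' hc₂y.isReflection
        hxb₃.isReflection hb₃c₂.isReflection'
    exact ⟨b₁, b₃, c₁, c₂, hb'.symm, hc.symm, hxb₁, hxb₃, hb₁c₁, hb₁c₂,
      .of_isReflection (isReflection_mul_inv_comm hadj')
        (hb₃c₂.length_lt.trans (hlt.trans hb₂c₁.length_lt)), hb₃c₂, hc₁y, hc₂y⟩
  · exact ⟨b₁, b₂, c₁, c₂, hb.symm, hc.symm, hxb₁, hxb₂, hb₁c₁, hb₁c₂, hb₂c₁,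
      .of_isReflection (isReflection_mul_inv_comm hadj) hlt, hc₁y, hc₂y⟩

end BruhatGraph

end CoxeterSystem

/-! ### Special matchings of Bruhat intervals -/

namespace CoxeterSystem

section SpecialMatchings

variable {B W : Type*} [Group W] {M : CoxeterMatrix B} (cs : CoxeterSystem M W)

local prefix:100 "ℓ" => cs.length

/-- A special matching of the Bruhat interval `[z, w]`, given as a map on the whole group whose
values outside the interval are irrelevant. Covering relations are expressed as edges of the Bruhat
graph along which the length increases by one. -/
structure IsIntervalMatching (z w : W) (m : W → W) : Prop where
  mem : ∀ {v}, v ∈ cs.bruhatInterval z w → m v ∈ cs.bruhatInterval z w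
  invol : ∀ {v}, v ∈ cs.bruhatInterval z w → m (m v) = v
  cover : ∀ {v}, v ∈ cs.bruhatInterval z w →
    (cs.BruhatStep v (m v) ∧ ℓ (m v) = ℓ v + 1) ∨ (cs.BruhatStep (m v) v ∧ ℓ v = ℓ (m v) + 1)
  special : ∀ {x y}, x ∈ cs.bruhatInterval z w → y ∈ cs.bruhatInterval z w →
    cs.BruhatStep x y → ℓ y = ℓ x + 1 → m x = y ∨ (cs.BruhatLE (m x) (m y) ∧ m x ≠ m y)

variable {cs} {z w : W} {m : W → W}

theorem IsIntervalMatching.injOn (hm : cs.IsIntervalMatching z w m) :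
    Set.InjOn m (cs.bruhatInterval z w) := by
  intro x hx y hy h
  rw [← hm.invol hx, h, hm.invol hy]

/-- A special matching preserves the edges of the Bruhat graph of covering type. -/
theorem IsIntervalMatching.isReflection_of_cover [Finite W] (hM : ∀ i j, M i j ≠ 0)
    (hm : cs.IsIntervalMatching z w m) {x y : W} (hx : x ∈ cs.bruhatInterval z w)
    (hy : y ∈ cs.bruhatInterval z w) (hxy : cs.BruhatStep x y) (hl : ℓ y = ℓ x + 1) :
    cs.IsReflection (m y * (m x)⁻¹) := by
  rcases hm.special hx hy hxy hl with h | ⟨hle, hne⟩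
  · rw [← h, hm.invol hx, h]
    exact hxy.isReflection'
  have hlt := hle.length_lt_of_ne hne
  rcases hm.cover hx with ⟨hx1, hx2⟩ | ⟨hx1, hx2⟩ <;>
    rcases hm.cover hy with ⟨hy1, hy2⟩ | ⟨hy1, hy2⟩
  · exact (hle.bruhatStep_of_length_eq (by omega)).isReflection
  · omega
  -- Here `m x ⋖ x ⋖ y ⋖ m y`; the interval from `m x` to `m y` is a crown of covering relations.
  · obtain ⟨x', hne', h1, h2⟩ := exists_ne_bruhatStep_bruhatStep hM hx1 hxy
    have l1 := h1.length_lt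
    have l2 := h2.length_lt
    have hmx := hm.mem hx
    have hx' : x' ∈ cs.bruhatInterval z w := ⟨hmx.1.trans h1.le, h2.le.trans hy.2⟩
    have h3 : cs.BruhatLE x (m x') ∧ x ≠ m x' := by
      have := hm.special hmx hx' h1 (by omega)
      rw [hm.invol hx] at this
      exact this.resolve_left hne'.symm
    have l3 := h3.1.length_lt_of_ne h3.2
    obtain ⟨h4, l4⟩ := (hm.cover hx').resolve_right (by omega)
    have h5 : cs.BruhatLE (m x') (m y) ∧ m x' ≠ m y := by
      refine (hm.special hx' hy h2 (by omega)).resolve_left fun h => ?_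
      have := hm.invol hx'
      rw [h] at this
      rw [this] at hy2
      omega
    have h6 := h5.1.bruhatStep_of_length_eq (by omega)
    have h7 := h3.1.bruhatStep_of_length_eq (by omega)
    have hne1 : m x ≠ y := by
      intro h
      rw [h] at hx2
      omega
    have hne2 : y ≠ m x' := by
      rintro h
      rw [h, hm.invol hx', ← h] at hy2
      omega
    exact cs.isReflection_of_bipartite hM hne1 hne2 hne'.symm hx1.isReflection h1.isReflection
      hxy.isReflection' h2.isReflection' h7.isReflection' h4.isReflection' hy1.isReflection
      h6.isReflection
  · exact (hle.bruhatStep_of_length_eq (by omega)).isReflection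

/-- A special matching of a Bruhat interval is an automorphism of its Bruhat graph. Edges that are
not covering relations are completed from shorter ones by a crown. -/
theorem IsIntervalMatching.isReflection [Finite W] (hM : ∀ i j, M i j ≠ 0)
    (hm : cs.IsIntervalMatching z w m) {x y : W} (hx : x ∈ cs.bruhatInterval z w)
    (hy : y ∈ cs.bruhatInterval z w) (hxy : cs.BruhatStep x y) :
    cs.IsReflection (m y * (m x)⁻¹) := by
  induction hn : ℓ y - ℓ x using Nat.strong_induction_on generalizing x y with
  | _ n IH =>
  subst hn
  have hlt := hxy.length_lt
  have hpar := hxy.length_mod_two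
  by_cases hl : ℓ y = ℓ x + 1
  · exact hm.isReflection_of_cover hM hx hy hxy hl
  obtain ⟨b₁, b₂, c₁, c₂, hb, hc, xb₁, xb₂, b₁c₁, b₁c₂, b₂c₁, b₂c₂, c₁y, c₂y⟩ :=
    hxy.exists_crown hM (by omega)
  have l1 := xb₁.length_lt
  have l2 := xb₂.length_lt
  have l3 := b₁c₁.length_lt
  have l4 := b₁c₂.length_lt
  have l5 := b₂c₁.length_lt
  have l6 := b₂c₂.length_lt
  have l7 := c₁y.length_lt
  have l8 := c₂y.length_lt
  have hb₁ : b₁ ∈ cs.bruhatInterval z w :=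
    ⟨hx.1.trans xb₁.le, b₁c₁.le.trans (c₁y.le.trans hy.2)⟩
  have hb₂ : b₂ ∈ cs.bruhatInterval z w :=
    ⟨hx.1.trans xb₂.le, b₂c₁.le.trans (c₁y.le.trans hy.2)⟩
  have hc₁ : c₁ ∈ cs.bruhatInterval z w := ⟨hb₁.1.trans b₁c₁.le, c₁y.le.trans hy.2⟩
  have hc₂ : c₂ ∈ cs.bruhatInterval z w := ⟨hb₁.1.trans b₁c₂.le, c₂y.le.trans hy.2⟩
  have hxc₁ : x ≠ c₁ := by
    rintro rfl
    omega
  exact cs.isReflection_of_bipartite hM (hm.injOn.ne hx hc₁ hxc₁) (hm.injOn.ne hc₁ hc₂ hc)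
    (hm.injOn.ne hb₁ hb₂ hb) (IH _ (by omega) hx hb₁ xb₁ rfl) (IH _ (by omega) hx hb₂ xb₂ rfl)
    (isReflection_mul_inv_comm (IH _ (by omega) hb₁ hc₁ b₁c₁ rfl))
    (isReflection_mul_inv_comm (IH _ (by omega) hb₂ hc₁ b₂c₁ rfl))
    (isReflection_mul_inv_comm (IH _ (by omega) hb₁ hc₂ b₁c₂ rfl))
    (isReflection_mul_inv_comm (IH _ (by omega) hb₂ hc₂ b₂c₂ rfl))
    (IH _ (by omega) hc₁ hy c₁y rfl) (IH _ (by omega) hc₂ hy c₂y rfl)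

variable (cs) in
/-- The vertices of the Bruhat graph below `w` reached by an edge starting at `z`. -/
def upperNeighbors (w z : W) : Set W :=
  {v | cs.BruhatStep z v ∧ cs.BruhatLE v w}

theorem bruhatDegree_eq_ncard_upperNeighbors (z w : W) (h : z ∈ cs.bruhatInterval z w) :
    cs.bruhatDegree z w ⟨z, h⟩ = (cs.upperNeighbors w z).ncard := by
  rw [bruhatDegree, ← Set.ncard_image_of_injective _ Subtype.val_injective]
  congr 1
  ext v
  constructor
  · rintro ⟨⟨v, hv⟩, hadj | hadj, rfl⟩
    · exact ⟨hadj, hv.2⟩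
    · have h1 : cs.BruhatStep v z := hadj
      have h2 := h1.length_lt
      have h3 := hv.1.length_lt_of_ne h1.ne.symm
      omega
  · rintro ⟨h1, h2⟩
    exact ⟨⟨v, h1.le, h2⟩, Or.inl h1, rfl⟩

/-- A special matching of `[z, w]` carries the edges at `m z` to the edges at `z`. At `m z` exactly
one edge, the one to `z`, goes down, while at `z` all edges go up. -/
theorem IsIntervalMatching.ncard_upperNeighbors [Finite W] (hM : ∀ i j, M i j ≠ 0)
    (hm : cs.IsIntervalMatching z w m) (hzw : cs.BruhatLE z w) :
    ℓ (m z) = ℓ z + 1 ∧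
      (cs.upperNeighbors w z).ncard = (cs.upperNeighbors w (m z)).ncard + 1 := by
  have hz : z ∈ cs.bruhatInterval z w := ⟨.refl, hzw⟩
  have hmz := hm.mem hz
  obtain ⟨hstep, hl⟩ : cs.BruhatStep z (m z) ∧ ℓ (m z) = ℓ z + 1 := by
    refine (hm.cover hz).resolve_right ?_
    rintro ⟨h1, h2⟩
    have := hmz.1.length_lt_of_ne h1.ne.symm
    omega
  refine ⟨hl, ?_⟩
  have hnot : z ∉ cs.upperNeighbors w (m z) := by
    rintro ⟨h, -⟩
    have := h.length_lt
    omega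
  have hsub : insert z (cs.upperNeighbors w (m z)) ⊆ cs.bruhatInterval z w := by
    rintro v (rfl | ⟨h1, h2⟩)
    · exact hz
    · exact ⟨hmz.1.trans h1.le, h2⟩
  rw [← Set.ncard_insert_of_notMem hnot (Set.toFinite _),
    ← (hm.injOn.mono hsub).ncard_image]
  congr 1
  ext v
  constructor
  · rintro ⟨h1, h2⟩
    have hv : v ∈ cs.bruhatInterval z w := ⟨h1.le, h2⟩
    have hmv := hm.mem hv
    refine ⟨m v, ?_, hm.invol hv⟩
    have hadj := hm.isReflection hM hz hv h1
    rcases lt_or_gt_of_ne (length_ne_of_isReflection hadj) with hlt | hlt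
    · exact Or.inr ⟨.of_isReflection hadj hlt, hmv.2⟩
    · left
      by_contra hne
      have := hmv.1.length_lt_of_ne (Ne.symm hne)
      omega
  · rintro ⟨v, hv | hv, rfl⟩
    · subst hv
      exact ⟨hstep, hmz.2⟩
    · have hvI := hsub (Or.inr hv)
      have hmv := hm.mem hvI
      have hadj := hm.isReflection hM hmz hvI hv.1
      rw [hm.invol hz] at hadj
      have hne : z ≠ m v := fun h => length_ne_of_isReflection hadj (by rw [← h])
      exact ⟨.of_isReflection hadj (hmv.1.length_lt_of_ne hne), hmv.2⟩

/-- In a dual Bruhat interval, a principal order ideal is a dual Bruhat interval, whose covering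
relations are the edges of the Bruhat graph with length difference one. -/
theorem covBy_iff_of_dual_bruhatInterval [Finite W] (hM : ∀ i j, M i j ≠ 0) {u w : W}
    {x₀ : (cs.bruhatInterval u w)ᵒᵈ} (a b : Set.Iic x₀) :
    a ⋖ b ↔ cs.BruhatStep (OrderDual.ofDual b.1).1 (OrderDual.ofDual a.1).1 ∧
      ℓ (OrderDual.ofDual a.1).1 = ℓ (OrderDual.ofDual b.1).1 + 1 := by
  have hle : ∀ a b : Set.Iic x₀, a ≤ b ↔
      cs.BruhatLE (OrderDual.ofDual b.1).1 (OrderDual.ofDual a.1).1 := fun _ _ => Iff.rfl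
  have hext : ∀ a b : Set.Iic x₀,
      (OrderDual.ofDual a.1).1 = (OrderDual.ofDual b.1).1 → a = b := by
    rintro ⟨a, ha⟩ ⟨b, hb⟩ h
    exact Subtype.ext (Subtype.ext h)
  have hlt : ∀ a b : Set.Iic x₀, a < b →
      ℓ (OrderDual.ofDual b.1).1 < ℓ (OrderDual.ofDual a.1).1 := fun a b h =>
    ((hle a b).1 h.le).length_lt_of_ne fun h' => h.ne (hext _ _ h'.symm)
  -- every element between two elements of the ideal lies in the ideal
  have hmid : ∀ (a b : Set.Iic x₀) (c : W), cs.BruhatLE (OrderDual.ofDual b.1).1 c →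
      cs.BruhatLE c (OrderDual.ofDual a.1).1 →
      ∃ c' : Set.Iic x₀, (OrderDual.ofDual c'.1).1 = c := by
    rintro ⟨⟨a, ha⟩, ha'⟩ ⟨⟨b, hb⟩, hb'⟩ c hbc hca
    have hb'' : cs.BruhatLE (OrderDual.ofDual x₀).1 b := hb'
    exact ⟨⟨OrderDual.toDual ⟨c, hb.1.trans hbc, hca.trans ha.2⟩, hb''.trans hbc⟩, rfl⟩
  constructor
  · intro h
    have hab := (hle a b).1 h.le
    have hstep : cs.BruhatStep (OrderDual.ofDual b.1).1 (OrderDual.ofDual a.1).1 := by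
      rcases Relation.ReflTransGen.cases_head hab with h' | ⟨c, hc, hca⟩
      · exact absurd (hext _ _ h'.symm) h.lt.ne
      · obtain ⟨c', rfl⟩ := hmid a b c hc.le hca
        have hcb : c' < b := lt_of_le_of_ne ((hle _ _).2 hc.le) (by
          rintro rfl
          exact hc.ne rfl)
        have : ¬ a < c' := fun hac => h.2 hac hcb
        have hac : a = c' := by
          by_contra hne
          exact this (lt_of_le_of_ne ((hle _ _).2 hca) hne)
        rwa [hac]
    refine ⟨hstep, ?_⟩
    by_contra hl
    have h1 := hstep.length_lt
    have h2 := hstep.length_mod_two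
    obtain ⟨c, d, hbc, hcd, hda⟩ := hstep.exists_path hM (by omega)
    obtain ⟨c', rfl⟩ := hmid a b c hbc.le (hcd.le.trans hda.le)
    refine h.2 (c := c') (lt_of_le_of_ne ((hle _ _).2 (hcd.le.trans hda.le)) ?_)
      (lt_of_le_of_ne ((hle _ _).2 hbc.le) ?_)
    · rintro rfl
      have h3 := hcd.length_lt
      have h4 := hda.length_lt
      omega
    · rintro rfl
      exact hbc.ne rfl
  · rintro ⟨h1, h2⟩
    refine ⟨lt_of_le_of_ne ((hle _ _).2 h1.le) ?_, fun c hac hcb => ?_⟩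
    · rintro rfl
      exact h1.ne rfl
    · have h3 := hlt _ _ hac
      have h4 := hlt _ _ hcb
      omega

/-- A dual zircon structure on `[u, w]` yields special matchings of the intervals `[z, w]`. -/
theorem exists_isIntervalMatching_of_isZircon [Finite W] (hM : ∀ i j, M i j ≠ 0) {u w z : W}
    (hz : IsZircon (cs.bruhatInterval u w)ᵒᵈ) (hzI : z ∈ cs.bruhatInterval u w) (hne : z ≠ w) :
    ∃ m, cs.IsIntervalMatching z w m := by
  classical
  have huw : cs.BruhatLE u w := hzI.1.trans hzI.2
  let x₀ : (cs.bruhatInterval u w)ᵒᵈ := OrderDual.toDual ⟨z, hzI⟩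
  have hx₀ : ¬ IsMin x₀ := by
    intro h
    have h1 : x₀ ≤ OrderDual.toDual ⟨w, huw, .refl⟩ :=
      h (show OrderDual.toDual ⟨w, huw, .refl⟩ ≤ x₀ from hzI.2)
    have h2 : cs.BruhatLE w z := h1
    have h3 := h2.length_lt_of_ne hne.symm
    have h4 := hzI.2.length_lt_of_ne hne
    omega
  obtain ⟨-, N, ⟨hinv, hcov⟩, hspec⟩ := hz x₀ hx₀
  let val : Set.Iic x₀ → W := fun a => (OrderDual.ofDual a.1).1
  have hval : ∀ a, val a ∈ cs.bruhatInterval z w := fun a => ⟨a.2, (OrderDual.ofDual a.1).2.2⟩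
  let emb : ∀ v, v ∈ cs.bruhatInterval z w → Set.Iic x₀ := fun v hv =>
    ⟨OrderDual.toDual ⟨v, hzI.1.trans hv.1, hv.2⟩, hv.1⟩
  have hemb : ∀ a, emb (val a) (hval a) = a := fun a => rfl
  let m : W → W := fun v => if hv : v ∈ cs.bruhatInterval z w then val (N (emb v hv)) else v
  have hmval : ∀ a, m (val a) = val (N a) := by
    intro a
    simp only [m, dif_pos (hval a), hemb]
  have hsurj : ∀ {v}, v ∈ cs.bruhatInterval z w → ∃ a, val a = v := fun {v} hv =>
    ⟨emb v hv, rfl⟩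
  have hvinj : Function.Injective val := fun a b h => Subtype.ext (Subtype.ext h)
  refine ⟨m, ⟨?_, ?_, ?_, ?_⟩⟩
  · intro v hv
    obtain ⟨a, rfl⟩ := hsurj hv
    rw [hmval]
    exact hval _
  · intro v hv
    obtain ⟨a, rfl⟩ := hsurj hv
    rw [hmval, hmval, hinv]
  · intro v hv
    obtain ⟨a, rfl⟩ := hsurj hv
    rw [hmval]
    rcases hcov a with h | h
    · exact Or.inl ((covBy_iff_of_dual_bruhatInterval hM _ _).1 h)
    · exact Or.inr ((covBy_iff_of_dual_bruhatInterval hM _ _).1 h)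
  · intro x y hx hy hxy hl
    obtain ⟨a, rfl⟩ := hsurj hx
    obtain ⟨b, rfl⟩ := hsurj hy
    rw [hmval, hmval]
    -- The order is reversed: `b` is covered by `a`.
    rcases hspec b a ((covBy_iff_of_dual_bruhatInterval hM _ _).2 ⟨hxy, hl⟩) with h | h
    · left
      rw [← h, hinv]
    · exact Or.inr ⟨h.le, fun h' => h.ne (hvinj h').symm⟩

/-- The Carrell–Peterson condition for an interval whose dual is a zircon. -/
theorem ncard_upperNeighbors_of_isZircon [Finite W] (hM : ∀ i j, M i j ≠ 0) {u w z : W}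
    (hz : IsZircon (cs.bruhatInterval u w)ᵒᵈ) (hzI : z ∈ cs.bruhatInterval u w) :
    (cs.upperNeighbors w z).ncard + ℓ z = ℓ w := by
  induction hn : ℓ w - ℓ z generalizing z with
  | zero =>
    have hzw : z = w := by
      by_contra hne
      have := hzI.2.length_lt_of_ne hne
      omega
    subst hzw
    have : cs.upperNeighbors z z = ∅ := by
      refine Set.eq_empty_of_forall_notMem ?_
      rintro v ⟨h1, h2⟩
      have h3 := h1.length_lt
      have h4 := h2.length_lt_of_ne h1.ne.symm
      omega
    rw [this, Set.ncard_empty, zero_add]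
  | succ n ih =>
    have hne : z ≠ w := by
      rintro rfl
      omega
    obtain ⟨m, hm⟩ := exists_isIntervalMatching_of_isZircon hM hz hzI hne
    obtain ⟨hl, hcard⟩ := hm.ncard_upperNeighbors hM hzI.2
    have hmz := hm.mem ⟨.refl, hzI.2⟩
    have := ih ⟨hzI.1.trans hmz.1, hmz.2⟩ (by omega)
    omega

end SpecialMatchings

theorem IsWeyl.coxeterMatrix_ne_zero {B W : Type*} [Group W] {M : CoxeterMatrix B}
    {cs : CoxeterSystem M W} (hW : cs.IsWeyl) (i j : B) : M i j ≠ 0 := by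
  by_cases hij : i = j
  · subst hij
    simp
  · have := hW.crystallographic i j hij
    omega

end CoxeterSystem

theorem mainTheorem1 {B W : Type*} [Group W] {M : CoxeterMatrix B} (cs : CoxeterSystem M W)
    (hW : cs.IsWeyl) (u w : W) (huw : cs.bruhatOrder.lt u w)
    (hz : IsZircon (cs.bruhatInterval u w)ᵒᵈ) :
    cs.IsRationallySmooth u w := by
  have := hW.finite
  intro y hy
  have h := CoxeterSystem.ncard_upperNeighbors_of_isZircon hW.coxeterMatrix_ne_zero hz hy
  have hd := CoxeterSystem.bruhatDegree_eq_ncard_upperNeighbors (cs := cs) y w ⟨.refl, hy.2⟩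
  rw [← hd] at h
  exact eq_sub_of_add_eq (by exact_mod_cast h)
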